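/- Setting. Let $X$ be a set of instances, $P$ a probability measure (on some $\sigma$-algebra) on $X\times\{0,1\}$; "for almost every $x$" means for $P$-almost every $(x,y)$. Let $\mathcal H$ be a (finite or infinite) set of classifiers $h:X\to\{0,1\}$, $(x_i,y_i)_{i=1}^m$ a labelled sample, and let $M$ be the finite set of error rows $\eta_h\in\{0,1\}^m$, $\eta_h(i)=\mathbf 1[h(x_i)\ne y_i]$, $h\in\mathcal H$. A tie-breaking function $\mathrm{AdaSelect}$ picks an element of every nonempty subset of $M$, and for every $\eta\in M$ a representative $h^\eta\in\mathcal H$ with $\eta_{h^\eta}=\eta$ is fixed; the weak learner always returns representatives. When used as a weak hypothesis in the score below, $h^\eta(x)$ is read as $\pm1$ ($1\mapsto 1$, $0\mapsto-1$). On the simplex $\Delta_m$ put $\epsilon(w)=\min_{\eta\in M}\eta\cdot w$, $\eta^w=\mathrm{AdaSelect}(\operatorname{argmin}_{\eta\in M}\eta\cdot w)$, $\alpha(w)=\frac12\log\frac{1-\epsilon(w)}{\epsilon(w)}$ and $$[\mathcal A(w)]_i=\tfrac12\,w(i)\Big(\tfrac1{\eta^w\cdot w}\Big)^{\eta^w(i)}\Big(\tfrac1{1-\eta^w\cdot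 w}\Big)^{1-\eta^w(i)} .$$ The update $\mathcal A$ is defined on $\Delta_m^{\circ}=\{w\in\Delta_m: 0<\epsilon(w)<1\}$ and maps this set to itself. For an initial weight $w_1\in\Delta_m^\circ$ let $w_t=\mathcal A^{(t-1)}(w_1)$, $F_T(x)=\sum_{t=1}^T\alpha(w_t)\,h^{\eta^{w_t}}(x)$ and $H_T(x)=\operatorname{sign}(F_T(x))$, with $\operatorname{sign}(0)=0$. Let $\Omega_\infty=\bigcap_{t\ge1}\mathcal A^{(t)}(\Delta_m^\circ)$, and $\sigma(\eta)=\{w\in\Delta_m:\eta\in\operatorname{argmin}_{\eta'\in M}\eta'\cdot w\}$. Call a Borel probability measure $\mu$ on $\Delta_m$ *invariant* if $\mu(\Delta_m^\circ)=1$ and $\mathcal A$ preserves $\mu$. The *no-ties assumption* says: there is a compact $G\subseteq\Delta_m$ with $\Omega_\infty\subseteq G$ such that for all $\eta,\eta'\in M$ either $\sigma(\eta)\cap\sigma(\eta')\cap G=\emptyset$, or $\sum_{i:\eta(i)\ne\eta'(i)}w(i)=0$ for all $w\in G$. Theorem. 1. If the no-ties assumption holds and $\Omega_\infty\neq\emptyset$,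 then an invariant probability measure $\mu$ exists. 2. For every invariant probability measure $\mu$ and $\mu$-almost every initial weight $w_1$: the limit $F^*(x)=\lim_{T\to\infty}\frac1TF_T(x)$ exists for every $x\in X$; and if $F^*(x)\neq0$ for almost every $x$, then for almost every $x$ the limit $H^*(x)=\lim_{T\to\infty}H_T(x)$ exists and equals $\operatorname{sign}(F^*(x))$. 3. For every single initial weight $w_1\in\Delta_m^\circ$: if for almost every $x$ the limit $F^*(x)=\lim_{T\to\infty}\frac1TF_T(x)$ exists and is nonzero, then for almost every $x$ the limit $H^*(x)=\lim_{T\to\infty}H_T(x)$ exists and equals $\operatorname{sign}(F^*(x))$. -/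

import Mathlib

open Filter Topology MeasureTheory

noncomputable section

namespace AdaBoost

/-- A row of the error matrix: `true` at `i` means that training example `i` is misclassified. -/
abbrev Row (m : ℕ) := Fin m → Bool

/-- The error row of a hypothesis `h` on the labelled sample `(pt i, label i)`. -/
def errorRow {X : Type*} {m : ℕ} (pt : Fin m → X) (label : Fin m → Bool) (h : X → Bool) : Row m :=
  fun i => h (pt i) != label i

/-- The error matrix, viewed as the (finite) set of its rows. -/
def errorMatrix {X : Type*} {m : ℕ} (hyp : Set (X → Bool)) (pt : Fin m → X)
    (label : Fin m → Bool) : Set (Row m) :=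
  errorRow pt label '' hyp

/-- The data of Optimal AdaBoost when the weak learner always uses a fixed representative
hypothesis of each error row: a hypothesis space (finite or infinite), a labelled training sample,
a tie-breaking function choosing one row from each nonempty set of rows, and a representative
hypothesis `rep η` for every row `η` of the error matrix. -/
structure Setup (X : Type*) (m : ℕ) where
  hyp : Set (X → Bool)
  pt : Fin m → X
  label : Fin m → Bool
  select : Set (Row m) → Row m
  rep : Row m → X → Bool
  select_mem : ∀ A ⊆ errorMatrix hyp pt label, A.Nonempty → select A ∈ A
  rep_mem : ∀ η ∈ errorMatrix hyp pt label, rep η ∈ hyp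
  rep_row : ∀ η ∈ errorMatrix hyp pt label, errorRow pt label (rep η) = η

/-- The weighted error `η · w` of a row. -/
def err {m : ℕ} (η : Row m) (w : Fin m → ℝ) : ℝ :=
  ∑ i, if η i then w i else 0

/-- The hypothetical weight update `T_η`. -/
def update {m : ℕ} (η : Row m) (w : Fin m → ℝ) : Fin m → ℝ :=
  fun i => 1 / 2 * w i * (if η i then 1 / err η w else 1 / (1 - err η w))

/-- The numerical value `+1` or `-1` of a binary label. -/
def pm (b : Bool) : ℝ := if b then 1 else -1

namespace Setup

variable {X : Type*} {m : ℕ} (S : Setup X m)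

/-- The set of rows of the error matrix. -/
def rows : Set (Row m) := errorMatrix S.hyp S.pt S.label

/-- The rows of least weighted error at `w`. -/
def argmin (w : Fin m → ℝ) : Set (Row m) :=
  {η | η ∈ S.rows ∧ ∀ η' ∈ S.rows, err η w ≤ err η' w}

/-- The selected row `η^w`. -/
def best (w : Fin m → ℝ) : Row m := S.select (S.argmin w)

/-- The region `σ(η)` of weights at which `η` has least error. -/
def region (η : Row m) : Set (Fin m → ℝ) := {w | w ∈ stdSimplex ℝ (Fin m) ∧ η ∈ S.argmin w}

/-- The AdaBoost weight update. -/
def ada (w : Fin m → ℝ) : Fin m → ℝ := update (S.best w) w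

/-- The least weighted error `ε(w)`, a minimum over the finite set of rows. -/
def eps (w : Fin m → ℝ) : ℝ := sInf ((fun η => err η w) '' S.rows)

/-- The coefficient `α(w)`. -/
def alpha (w : Fin m → ℝ) : ℝ := 1 / 2 * Real.log ((1 - S.eps w) / S.eps w)

/-- The points of the simplex at which the update and the coefficient are defined, that is, at
which the denominators `ε(w)` and `1 - ε(w)` do not vanish. The update maps this set to itself. -/
def dom : Set (Fin m → ℝ) := {w | w ∈ stdSimplex ℝ (Fin m) ∧ 0 < S.eps w ∧ S.eps w < 1}

/-- The weights that can be reached after any number `t ≥ 1` of rounds. -/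
def attractor : Set (Fin m → ℝ) := ⋂ t : ℕ, S.ada^[t + 1] '' S.dom

/-- Optimal AdaBoost eventually has no ties. -/
def NoTies : Prop :=
  ∃ G : Set (Fin m → ℝ), IsCompact G ∧ G ⊆ stdSimplex ℝ (Fin m) ∧ S.attractor ⊆ G ∧
    ∀ η ∈ S.rows, ∀ η' ∈ S.rows,
      S.region η ∩ S.region η' ∩ G = ∅ ∨
        ∀ w ∈ G, ∑ i with η i ≠ η' i, w i = 0

/-- `μ` is a Borel probability measure on the weight simplex which is preserved by the AdaBoost
update (in particular the update is defined `μ`-almost everywhere). -/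
structure IsInvariant (μ : Measure (Fin m → ℝ)) : Prop where
  prob : IsProbabilityMeasure μ
  defined : ∀ᵐ w ∂μ, w ∈ S.dom
  preserving : MeasurePreserving S.ada μ μ

/-- The combined score `F_T(x) = ∑ α_t h_t(x)` over the first `T` rounds, started from the weight
`w₁`; the weight of round `t + 1` is the `t`-th iterate of the update at `w₁`. -/
def score (w₁ : Fin m → ℝ) (T : ℕ) (x : X) : ℝ :=
  ∑ t ∈ Finset.range T, S.alpha (S.ada^[t] w₁) * pm (S.rep (S.best (S.ada^[t] w₁)) x)

/-- The AdaBoost classifier `H_T(x)`. -/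
def classifier (w₁ : Fin m → ℝ) (T : ℕ) (x : X) : ℝ := Real.sign (S.score w₁ T x)

end Setup

end AdaBoost

end

/-! The obstacle is that `α` is unbounded near `ε = 0`; neither integrability nor compactness is
available for free. Both are recovered from the potentials `log w(i) ≤ 0`. After one round `ε ≤
1/2`, so a round at most halves a coordinate, while some misclassified coordinate of positive weight
is multiplied by exactly `1/(2ε)`. Hence `-log (2ε)` is at most the sum over `i` of the increments
of `log w(i)`, each raised by `log 2` (`neg_log_eps_le_sum`).

For an invariant measure, each increment is a coboundary bounded below, hence integrable
(`integrable_comp_sub_of_nonpos`), and so is `α`. The maximal ergodic inequality gives Birkhoff's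
theorem, which is applied to `α` split by the selected row. There are finitely many rows, so one
null set of weights serves all `x`.

For existence, the same inequality telescoped along an orbit bounds the averages of `-log (2ε)`.
This function is proper on the orbit closure with `ε = 0` removed, where absence of ties makes the
update continuous; tightness and the Krylov–Bogoliubov argument give the measure.

Finally, a score average with nonzero limit eventually has the sign of that limit
(`tendsto_classifier`). -/

noncomputable section

/-! ### The pointwise ergodic theorem and integrability of coboundaries. -/

section Birkhoff

variable {Ω : Type*}

/-- The running maximum of the Birkhoff sums of length at most `n`, including the empty one. -/
def birkhoffMax (f : Ω → Ω) (g : Ω → ℝ) : ℕ → Ω → ℝ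
  | 0 => fun _ => 0
  | n + 1 => fun x => max 0 (g x + birkhoffMax f g n (f x))

theorem birkhoffMax_nonneg (f : Ω → Ω) (g : Ω → ℝ) (n : ℕ) (x : Ω) : 0 ≤ birkhoffMax f g n x := by
  cases n with
  | zero => exact le_rfl
  | succ n => exact le_max_left _ _

theorem birkhoffMax_le_succ (f : Ω → Ω) (g : Ω → ℝ) (n : ℕ) (x : Ω) :
    birkhoffMax f g n x ≤ birkhoffMax f g (n + 1) x := by
  induction n generalizing x with
  | zero => exact le_max_left _ _
  | succ n ih => exact max_le_max le_rfl (by linarith [ih (f x)])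

theorem birkhoffSum_le_birkhoffMax (f : Ω → Ω) (g : Ω → ℝ) (n : ℕ) (x : Ω) :
    birkhoffSum f g n x ≤ birkhoffMax f g n x := by
  induction n generalizing x with
  | zero => simp [birkhoffMax]
  | succ n ih =>
    rw [birkhoffSum_succ']
    exact le_max_of_le_right (by linarith [ih (f x)])

variable [MeasurableSpace Ω]

theorem measurable_birkhoffMax {f : Ω → Ω} {g : Ω → ℝ} (hf : Measurable f) (hg : Measurable g)
    (n : ℕ) : Measurable (birkhoffMax f g n) := by
  induction n with
  | zero => exact measurable_const
  | succ n ih => exact measurable_const.max (hg.add (ih.comp hf))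

theorem integrable_birkhoffMax {μ : Measure Ω} {f : Ω → Ω} {g : Ω → ℝ}
    (hf : MeasurePreserving f μ μ) (hi : Integrable g μ) (n : ℕ) :
    Integrable (birkhoffMax f g n) μ := by
  induction n with
  | zero => exact integrable_zero _ _ _
  | succ n ih =>
    exact (integrable_zero _ _ _).sup (hi.add (hf.integrable_comp_of_integrable ih))

/-- The maximal ergodic inequality, on the set where some running maximum is positive. -/
theorem setIntegral_birkhoffMax_pos_nonneg {μ : Measure Ω} {f : Ω → Ω} {g : Ω → ℝ}
    (hf : MeasurePreserving f μ μ) (hg : Measurable g) (hi : Integrable g μ) (n : ℕ) :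
    0 ≤ ∫ x in {x | 0 < birkhoffMax f g n x}, g x ∂μ := by
  set M := birkhoffMax f g n with hM
  have hMm : Measurable M := measurable_birkhoffMax hf.measurable hg n
  have hMi : Integrable M μ := integrable_birkhoffMax hf hi n
  have hMfi : Integrable (fun x => M (f x)) μ := hf.integrable_comp_of_integrable hMi
  set E := {x | 0 < M x} with hE
  have hEm : MeasurableSet E := measurableSet_lt measurable_const hMm
  -- Where the maximum is positive it is attained by a nonempty sum, so it equals `g x` plus the
  -- shorter maximum at `f x`, and that is at most `M (f x)`.
  have key : ∀ x ∈ E, M x - M (f x) ≤ g x := by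
    intro x hx
    have hx' : 0 < birkhoffMax f g n x := hx
    cases n with
    | zero => exact absurd hx' (lt_irrefl _)
    | succ k =>
      have h1 : birkhoffMax f g (k + 1) x = g x + birkhoffMax f g k (f x) := by
        rcases max_choice 0 (g x + birkhoffMax f g k (f x)) with h | h
        · exact absurd (h ▸ hx' : (0 : ℝ) < 0) (lt_irrefl _)
        · exact h
      have := birkhoffMax_le_succ f g k (f x)
      simp only [hM]
      linarith
  have h1 : ∫ x in E, M x ∂μ = ∫ x, M x ∂μ := by
    refine setIntegral_eq_integral_of_forall_compl_eq_zero fun x hx => ?_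
    exact le_antisymm (not_lt.1 hx) (birkhoffMax_nonneg f g n x)
  have h2 : ∫ x in E, M (f x) ∂μ ≤ ∫ x, M (f x) ∂μ :=
    setIntegral_le_integral hMfi (Eventually.of_forall fun x => birkhoffMax_nonneg f g n (f x))
  have h3 : ∫ x, M (f x) ∂μ = ∫ x, M x ∂μ := by
    have := integral_map (μ := μ) hf.measurable.aemeasurable
      (f := M) (by exact hMm.aestronglyMeasurable)
    rw [← this, hf.map_eq]
  calc 0 ≤ ∫ x in E, M x ∂μ - ∫ x in E, M (f x) ∂μ := by linarith
    _ = ∫ x in E, (M x - M (f x)) ∂μ :=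
      (integral_sub hMi.integrableOn hMfi.integrableOn).symm
    _ ≤ _ := setIntegral_mono_on (hMi.sub hMfi).integrableOn hi.integrableOn hEm key

/-- If almost every point has a positive Birkhoff sum, then the integral is nonnegative. -/
theorem integral_nonneg_of_ae_exists_birkhoffSum_pos {μ : Measure Ω} {f : Ω → Ω} {g : Ω → ℝ}
    (hf : MeasurePreserving f μ μ) (hg : Measurable g) (hi : Integrable g μ)
    (h : ∀ᵐ x ∂μ, ∃ n, 0 < birkhoffSum f g n x) : 0 ≤ ∫ x, g x ∂μ := by
  set E : ℕ → Set Ω := fun n => {x | 0 < birkhoffMax f g n x}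
  have hmono : Monotone E := monotone_nat_of_le_succ fun n x hx =>
    lt_of_lt_of_le hx (birkhoffMax_le_succ f g n x)
  have hlim := tendsto_setIntegral_of_monotone (μ := μ) (f := g) (s := E)
    (fun n => measurableSet_lt measurable_const (measurable_birkhoffMax hf.measurable hg n))
    hmono hi.integrableOn
  have hU : (⋃ n, E n) =ᵐ[μ] Set.univ := by
    refine eventuallyEq_univ.2 ?_
    filter_upwards [h] with x ⟨n, hn⟩
    exact Set.mem_iUnion.2 ⟨n, hn.trans_le (birkhoffSum_le_birkhoffMax f g n x)⟩
  rw [setIntegral_congr_set hU, setIntegral_univ] at hlim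
  exact ge_of_tendsto' hlim fun n => setIntegral_birkhoffMax_pos_nonneg hf hg hi n

/-- The points whose Birkhoff averages are infinitely often above a rational exceeding `b`. -/
def birkhoffUpper (f : Ω → Ω) (g : Ω → ℝ) (b : ℝ) : Set Ω :=
  {x | ∃ q : ℚ, b < q ∧ ∃ᶠ n : ℕ in atTop, (q : ℝ) * n < birkhoffSum f g n x}

theorem measurable_birkhoffSum {f : Ω → Ω} {g : Ω → ℝ} (hf : Measurable f)
    (hg : Measurable g) (n : ℕ) : Measurable (birkhoffSum f g n) :=
  Finset.measurable_sum _ fun i _ => hg.comp (hf.iterate i)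

theorem measurableSet_birkhoffUpper {f : Ω → Ω} {g : Ω → ℝ} (hf : Measurable f)
    (hg : Measurable g) (b : ℝ) : MeasurableSet (birkhoffUpper f g b) := by
  have : birkhoffUpper f g b = ⋃ (q : ℚ) (_ : b < q), ⋂ N : ℕ, ⋃ (n : ℕ) (_ : N ≤ n),
      {x | (q : ℝ) * n < birkhoffSum f g n x} := by
    ext x
    simp [birkhoffUpper, frequently_atTop]
  rw [this]
  exact MeasurableSet.iUnion fun q => MeasurableSet.iUnion fun _ => MeasurableSet.iInter fun N =>
    MeasurableSet.iUnion fun n => MeasurableSet.iUnion fun _ =>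
      measurableSet_lt measurable_const (measurable_birkhoffSum hf hg n)

omit [MeasurableSpace Ω] in
-- Passing from `x` to `f x` shifts the index by one and changes the sum by `g x`. Replacing `q` by
-- a rational `r` with `b < r < q` leaves a linear gap that absorbs this.
theorem preimage_birkhoffUpper (f : Ω → Ω) (g : Ω → ℝ) (b : ℝ) :
    f ⁻¹' birkhoffUpper f g b = birkhoffUpper f g b := by
  have large : ∀ c d : ℝ, 0 < d → ∀ᶠ n : ℕ in atTop, c < d * n := fun c d hd =>
    (tendsto_natCast_atTop_atTop.const_mul_atTop hd).eventually_gt_atTop c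
  ext x
  constructor
  · rintro ⟨q, hq, hfr⟩
    obtain ⟨r, hr, hrq⟩ := exists_rat_btwn hq
    refine ⟨r, hr, ?_⟩
    have h := (hfr.and_eventually (large (r - g x) (q - r) (by linarith))).mono
      (q := fun n : ℕ => (r : ℝ) * (n + 1 : ℕ) < birkhoffSum f g (n + 1) x) fun n hn => by
        rw [birkhoffSum_succ']
        push_cast
        linarith [hn.1, hn.2]
    exact (tendsto_add_atTop_nat 1).frequently h
  · rintro ⟨q, hq, hfr⟩
    obtain ⟨r, hr, hrq⟩ := exists_rat_btwn hq
    refine ⟨r, hr, ?_⟩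
    have h := hfr.and_eventually ((large (g x - r) (q - r) (by linarith)).and
      (eventually_ge_atTop 1))
    refine (tendsto_sub_atTop_nat 1).frequently (h.mono fun n hn => ?_)
    obtain ⟨k, rfl⟩ := Nat.exists_eq_add_of_le' hn.2.2
    have h1 := hn.1
    have h2 := hn.2.1
    rw [birkhoffSum_succ'] at h1
    push_cast at h1 h2
    rw [Nat.add_sub_cancel]
    linarith

/-- If `A` is an invariant set all whose points have a Birkhoff sum of `g` exceeding that of the
constant `b`, then `b μ(A) ≤ ∫_A g`. -/
theorem mul_measureReal_le_setIntegral_of_invariant {μ : Measure Ω} [IsFiniteMeasure μ]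
    {f : Ω → Ω} {g : Ω → ℝ} (hf : MeasurePreserving f μ μ) (hg : Measurable g)
    (hi : Integrable g μ) {A : Set Ω} (hA : MeasurableSet A) (hfA : f ⁻¹' A = A) {b : ℝ}
    (h : ∀ x ∈ A, ∃ n : ℕ, b * n < birkhoffSum f g n x) :
    b * μ.real A ≤ ∫ x in A, g x ∂μ := by
  have hr : MeasurePreserving f (μ.restrict A) (μ.restrict A) := by
    have := hf.restrict_preimage hA
    rwa [hfA] at this
  have h1 := integral_nonneg_of_ae_exists_birkhoffSum_pos hr (hg.sub_const b)
    (hi.integrableOn.sub (integrable_const b)) ((ae_restrict_iff' hA).2 (Eventually.of_forall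
      fun x hx => (h x hx).imp fun n hn => by
        have h2 : birkhoffSum f (fun y => g y - b) n x = birkhoffSum f g n x - b * n := by
          simp [birkhoffSum, mul_comm]
        rw [h2]
        linarith))
  rw [integral_sub hi.integrableOn (integrable_const b), setIntegral_const, smul_eq_mul] at h1
  linarith

omit [MeasurableSpace Ω] in
theorem exists_lt_birkhoffSum_of_mem_birkhoffUpper {f : Ω → Ω} {g : Ω → ℝ} {b : ℝ} {x : Ω}
    (hx : x ∈ birkhoffUpper f g b) : ∃ n : ℕ, b * n < birkhoffSum f g n x := by
  obtain ⟨q, hq, hfr⟩ := hx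
  obtain ⟨n, hn⟩ := hfr.exists
  exact ⟨n, lt_of_le_of_lt (mul_le_mul_of_nonneg_right hq.le n.cast_nonneg) hn⟩

/-- On this invariant set `A`, applying the maximal inequality to `g` and to `-g` gives `b μ(A) ≤
∫_A g ≤ a μ(A)`. -/
theorem measure_birkhoffUpper_inter_eq_zero {μ : Measure Ω} [IsFiniteMeasure μ]
    {f : Ω → Ω} {g : Ω → ℝ} (hf : MeasurePreserving f μ μ) (hg : Measurable g)
    (hi : Integrable g μ) {a b : ℝ} (hab : a < b) :
    μ (birkhoffUpper f g b ∩ birkhoffUpper f (-g) (-a)) = 0 := by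
  set A := birkhoffUpper f g b ∩ birkhoffUpper f (-g) (-a)
  have hA : MeasurableSet A := (measurableSet_birkhoffUpper hf.measurable hg b).inter
    (measurableSet_birkhoffUpper hf.measurable hg.neg _)
  have hfA : f ⁻¹' A = A := by
    rw [Set.preimage_inter, preimage_birkhoffUpper, preimage_birkhoffUpper]
  have h1 := mul_measureReal_le_setIntegral_of_invariant hf hg hi hA hfA (b := b)
    fun x hx => exists_lt_birkhoffSum_of_mem_birkhoffUpper hx.1
  have h2 := mul_measureReal_le_setIntegral_of_invariant hf hg.neg hi.neg hA hfA (b := -a)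
    fun x hx => exists_lt_birkhoffSum_of_mem_birkhoffUpper hx.2
  simp only [Pi.neg_apply, integral_neg] at h2
  have h3 : 0 ≤ μ.real A := measureReal_nonneg
  have : μ.real A = 0 := by nlinarith
  exact (measureReal_eq_zero_iff).1 this

theorem measure_iInter_birkhoffUpper_eq_zero {μ : Measure Ω} [IsFiniteMeasure μ]
    {f : Ω → Ω} {g : Ω → ℝ} (hf : MeasurePreserving f μ μ) (hg : Measurable g)
    (hi : Integrable g μ) : μ (⋂ b : ℕ, birkhoffUpper f g b) = 0 := by
  set A := ⋂ b : ℕ, birkhoffUpper f g b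
  have hA : MeasurableSet A :=
    MeasurableSet.iInter fun b => measurableSet_birkhoffUpper hf.measurable hg b
  have hfA : f ⁻¹' A = A := by
    simp only [A, Set.preimage_iInter, preimage_birkhoffUpper]
  have h1 : ∀ b : ℕ, b * μ.real A ≤ ∫ x in A, g x ∂μ := fun b =>
    mul_measureReal_le_setIntegral_of_invariant hf hg hi hA hfA
      fun x hx => exists_lt_birkhoffSum_of_mem_birkhoffUpper (Set.mem_iInter.1 hx b)
  have : μ.real A = 0 := by
    by_contra hne
    have hpos : 0 < μ.real A := lt_of_le_of_ne measureReal_nonneg (Ne.symm hne)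
    obtain ⟨n, hn⟩ := exists_nat_gt ((∫ x in A, g x ∂μ) / μ.real A)
    rw [div_lt_iff₀ hpos] at hn
    linarith [h1 n]
  exact (measureReal_eq_zero_iff).1 this

omit [MeasurableSpace Ω] in
theorem mem_birkhoffUpper_of_frequently {f : Ω → Ω} {g : Ω → ℝ} {b c : ℝ} {x : Ω} (hbc : b < c)
    (h : ∃ᶠ n in atTop, c < birkhoffAverage ℝ f g n x) : x ∈ birkhoffUpper f g b := by
  obtain ⟨q, hbq, hqc⟩ := exists_rat_btwn hbc
  refine ⟨q, hbq, (h.and_eventually (eventually_gt_atTop 0)).mono fun n hn => ?_⟩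
  have hpos : (0 : ℝ) < n := by exact_mod_cast hn.2
  have h1 : (q : ℝ) < (n : ℝ)⁻¹ * birkhoffSum f g n x := hqc.trans hn.1
  rwa [inv_mul_eq_div, lt_div_iff₀ hpos] at h1

omit [MeasurableSpace Ω] in
theorem isBoundedUnder_birkhoffAverage_of_notMem {f : Ω → Ω} {g : Ω → ℝ} {x : Ω}
    (h : x ∉ ⋂ b : ℕ, birkhoffUpper f g b) :
    IsBoundedUnder (· ≤ ·) atTop fun n => birkhoffAverage ℝ f g n x := by
  simp only [Set.mem_iInter, not_forall] at h
  obtain ⟨b, hb⟩ := h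
  refine ⟨b + 1, ?_⟩
  have := mt (mem_birkhoffUpper_of_frequently (lt_add_one (b : ℝ))) hb
  rw [not_frequently] at this
  exact this.mono fun n hn => not_lt.1 hn

/-- The pointwise ergodic theorem for a finite measure. -/
theorem ae_tendsto_birkhoffAverage_of_measurable {μ : Measure Ω} [IsFiniteMeasure μ]
    {f : Ω → Ω} {g : Ω → ℝ} (hf : MeasurePreserving f μ μ) (hg : Measurable g)
    (hi : Integrable g μ) :
    ∀ᵐ x ∂μ, ∃ c : ℝ, Tendsto (fun n => birkhoffAverage ℝ f g n x) atTop (𝓝 c) := by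
  have h1 : ∀ᵐ x ∂μ, x ∉ ⋂ b : ℕ, birkhoffUpper f g b :=
    measure_eq_zero_iff_ae_notMem.1 (measure_iInter_birkhoffUpper_eq_zero hf hg hi)
  have h2 : ∀ᵐ x ∂μ, x ∉ ⋂ b : ℕ, birkhoffUpper f (-g) b :=
    measure_eq_zero_iff_ae_notMem.1 (measure_iInter_birkhoffUpper_eq_zero hf hg.neg hi.neg)
  have h3 : ∀ᵐ x ∂μ, ∀ a b : ℚ, (a : ℝ) < b →
      x ∉ birkhoffUpper f g b ∩ birkhoffUpper f (-g) (-a) := by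
    simp_rw [ae_all_iff]
    exact fun a b hab =>
      measure_eq_zero_iff_ae_notMem.1 (measure_birkhoffUpper_inter_eq_zero hf hg hi hab)
  filter_upwards [h1, h2, h3] with x hx1 hx2 hx3
  refine tendsto_of_no_upcrossings (Rat.denseRange_cast (𝕜 := ℝ)) ?_
    (isBoundedUnder_birkhoffAverage_of_notMem hx1) ?_
  · rintro _ ⟨a, rfl⟩ _ ⟨b, rfl⟩ hab ⟨ha, hb⟩
    -- `birkhoffUpper` demands a strict margin on either side, so the interval is shrunk to `a < p <
    -- q < b`.
    obtain ⟨p, hap, hpb⟩ := exists_rat_btwn hab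
    obtain ⟨q, hpq, hqb⟩ := exists_rat_btwn hpb
    refine hx3 p q hpq ⟨mem_birkhoffUpper_of_frequently hqb hb,
      mem_birkhoffUpper_of_frequently (neg_lt_neg hap) (ha.mono fun n hn => ?_)⟩
    rw [birkhoffAverage_neg]
    exact neg_lt_neg hn
  · obtain ⟨B, hB⟩ := isBoundedUnder_birkhoffAverage_of_notMem hx2
    refine ⟨-B, (eventually_map.1 hB).mono fun n hn => ?_⟩
    rw [birkhoffAverage_neg] at hn
    exact neg_le.1 hn

/-- A coboundary `h ∘ f - h` of a nonpositive function which is bounded below almost everywhere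
is integrable. -/
theorem integrable_comp_sub_of_nonpos {μ : Measure Ω} [IsFiniteMeasure μ] {f : Ω → Ω} {h : Ω → ℝ}
    (hf : MeasurePreserving f μ μ) (hm : Measurable h) (hn : ∀ᵐ x ∂μ, h x ≤ 0) {C : ℝ}
    (hC : 0 ≤ C) (hb : ∀ᵐ x ∂μ, -C ≤ h (f x) - h x) :
    Integrable (fun x => h (f x) - h x) μ := by
  -- The truncations are integrable, so their coboundaries have integral zero, and they keep the
  -- lower bound `-C`. Fatou's lemma then bounds the integral of the limit by `C μ(Ω)`.
  set φ : ℕ → Ω → ℝ := fun n x => max (-n) (h x)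
  have hφm : ∀ n, Measurable (φ n) := fun n => measurable_const.max hm
  have hφi : ∀ n, Integrable (φ n) μ := fun n => by
    refine Integrable.of_bound (hφm n).aestronglyMeasurable (n : ℝ) ?_
    filter_upwards [hn] with x hx
    rw [Real.norm_eq_abs, abs_le]
    exact ⟨le_max_left _ _, max_le (by linarith [(n.cast_nonneg : (0 : ℝ) ≤ n)])
      (hx.trans n.cast_nonneg)⟩
  have hφfi : ∀ n, Integrable (fun x => φ n (f x)) μ := fun n =>
    hf.integrable_comp_of_integrable (hφi n)
  have hint : ∀ n, ∫ x, (φ n (f x) - φ n x + C) ∂μ = C * μ.real Set.univ := fun n => by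
    have h1 : ∫ x, φ n (f x) ∂μ = ∫ x, φ n x ∂μ := by
      have := integral_map (μ := μ) hf.measurable.aemeasurable (hφm n).aestronglyMeasurable
      rw [← this, hf.map_eq]
    have h2 : Integrable (fun x => φ n (f x) - φ n x) μ := (hφfi n).sub (hφi n)
    rw [integral_add h2 (integrable_const C), integral_sub (hφfi n) (hφi n), h1, integral_const, smul_eq_mul]
    ring
  have hpos : ∀ n, ∀ᵐ x ∂μ, 0 ≤ φ n (f x) - φ n x + C := fun n => by
    filter_upwards [hb] with x hx
    have : φ n x ≤ φ n (f x) + C := max_le (by linarith [le_max_left (-(n : ℝ)) (h (f x))])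
      (by linarith [le_max_right (-(n : ℝ)) (h (f x))])
    linarith
  have hgi : Integrable (fun x => h (f x) - h x + C) μ := by
    have hGm : ∀ n, AEStronglyMeasurable (fun x => φ n (f x) - φ n x + C) μ := fun n =>
      (((hφfi n).sub (hφi n)).add (integrable_const C)).aestronglyMeasurable
    have hlim : ∀ x, Tendsto (fun n => φ n (f x) - φ n x + C) atTop (𝓝 (h (f x) - h x + C)) := by
      intro x
      refine tendsto_const_nhds.congr' ?_
      filter_upwards [eventually_ge_atTop ⌈max (-h x) (-h (f x))⌉₊] with n hn
      have := max_le_iff.1 (Nat.ceil_le.1 hn)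
      simp only [φ]
      rw [max_eq_right (by linarith), max_eq_right (by linarith)]
    refine ⟨(((hm.comp hf.measurable).sub hm).add_const C).aestronglyMeasurable, ?_⟩
    have hfin : ∀ n, ∫⁻ x, ‖φ n (f x) - φ n x + C‖ₑ ∂μ = ENNReal.ofReal (C * μ.real Set.univ) :=
      fun n => by
      have hi : Integrable (fun x => φ n (f x) - φ n x + C) μ :=
        ((hφfi n).sub (hφi n)).add (integrable_const C)
      rw [← hint n, ofReal_integral_eq_lintegral_ofReal hi (hpos n)]
      refine lintegral_congr_ae ?_
      filter_upwards [hpos n] with x hx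
      rw [Real.enorm_eq_ofReal hx]
    have hF := lintegral_liminf_le' (u := atTop) fun n => (hGm n).enorm
    simp only [(hlim _).enorm.liminf_eq, hfin, liminf_const] at hF
    exact hF.trans_lt ENNReal.ofReal_lt_top
  exact (hgi.sub (integrable_const C)).congr (Eventually.of_forall fun x => by simp)

end Birkhoff

/-! ### Invariant measures from tight orbit averages. -/

section KrylovBogoliubov

variable {Y : Type*} [MeasurableSpace Y]

/-- The uniform distribution on the first `n + 1` points of the orbit of `y`. -/
def orbitMeasure (f : Y → Y) (y : Y) (n : ℕ) : Measure Y :=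
  ((n + 1 : ℕ) : ENNReal)⁻¹ • ∑ t ∈ Finset.range (n + 1), Measure.dirac (f^[t] y)

instance isProbabilityMeasure_orbitMeasure (f : Y → Y) (y : Y) (n : ℕ) :
    IsProbabilityMeasure (orbitMeasure f y n) := by
  constructor
  rw [orbitMeasure, Measure.smul_apply, Measure.finsetSum_apply]
  simp only [measure_univ, Finset.sum_const, Finset.card_range, nsmul_eq_mul, mul_one, smul_eq_mul]
  exact ENNReal.inv_mul_cancel (by simp) (ENNReal.natCast_ne_top _)

theorem lintegral_orbitMeasure (f : Y → Y) (y : Y) (n : ℕ) {g : Y → ENNReal} (hg : Measurable g) :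
    ∫⁻ x, g x ∂orbitMeasure f y n =
      ((n + 1 : ℕ) : ENNReal)⁻¹ * ∑ t ∈ Finset.range (n + 1), g (f^[t] y) := by
  rw [orbitMeasure, lintegral_smul_measure, lintegral_finsetSum_measure, smul_eq_mul]
  simp_rw [lintegral_dirac' _ hg]

theorem integral_orbitMeasure (f : Y → Y) (y : Y) (n : ℕ) {g : Y → ℝ} (hg : StronglyMeasurable g) :
    ∫ x, g x ∂orbitMeasure f y n = birkhoffAverage ℝ f g (n + 1) y := by
  rw [orbitMeasure, integral_smul_measure, integral_finsetSum_measure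
    fun i _ => integrable_dirac' hg (by simp)]
  simp_rw [integral_dirac' _ _ hg]
  rw [birkhoffAverage, birkhoffSum, ENNReal.toReal_inv, ENNReal.toReal_natCast]

/-- Markov's inequality, uniform in `n`; this is the source of tightness. -/
theorem orbitMeasure_lt_le {f : Y → Y} {y : Y} {V : Y → ℝ} (hV : Measurable V)
    (hV0 : ∀ x, 0 ≤ V x) {C : ℝ} (h : ∀ n : ℕ, birkhoffSum f V (n + 1) y ≤ C * (n + 1 : ℕ))
    {c : ℝ} (hc : 0 < c) (n : ℕ) :
    orbitMeasure f y n {x | V x ≤ c}ᶜ ≤ ENNReal.ofReal (C / c) := by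
  have h0 : ENNReal.ofReal c ≠ 0 := by simpa using hc
  calc orbitMeasure f y n {x | V x ≤ c}ᶜ
      ≤ orbitMeasure f y n {x | ENNReal.ofReal c ≤ ENNReal.ofReal (V x)} :=
        measure_mono fun x hx => ENNReal.ofReal_le_ofReal (le_of_lt (not_le.1 hx))
    _ ≤ (∫⁻ x, ENNReal.ofReal (V x) ∂orbitMeasure f y n) / ENNReal.ofReal c :=
        meas_ge_le_lintegral_div hV.ennreal_ofReal.aemeasurable h0 ENNReal.ofReal_ne_top
    _ ≤ ENNReal.ofReal C / ENNReal.ofReal c := by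
        gcongr
        rw [lintegral_orbitMeasure f y n hV.ennreal_ofReal,
          ← ENNReal.ofReal_sum_of_nonneg fun t _ => hV0 _]
        rw [ENNReal.inv_mul_le_iff (by simp) (ENNReal.natCast_ne_top _), ← ENNReal.ofReal_natCast,
          ← ENNReal.ofReal_mul (Nat.cast_nonneg _), mul_comm]
        exact ENNReal.ofReal_le_ofReal (h n)
    _ = ENNReal.ofReal (C / c) := (ENNReal.ofReal_div_of_pos hc).symm

variable [TopologicalSpace Y] [TopologicalSpace.MetrizableSpace Y] [BorelSpace Y]

/-- Krylov–Bogoliubov: a continuous self-map has an invariant probability measure if a nonnegative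
function with compact sublevel sets has bounded Birkhoff averages along some orbit. -/
theorem exists_measurePreserving_of_birkhoffSum_le {f : Y → Y} (hf : Continuous f) {y : Y}
    {V : Y → ℝ} (hV : Measurable V) (hV0 : ∀ x, 0 ≤ V x) (hVc : ∀ c, IsCompact {x | V x ≤ c})
    {C : ℝ} (h : ∀ n : ℕ, birkhoffSum f V (n + 1) y ≤ C * (n + 1 : ℕ)) :
    ∃ μ : Measure Y, IsProbabilityMeasure μ ∧ MeasurePreserving f μ μ := by
  set μs : ℕ → ProbabilityMeasure Y := fun n => ⟨orbitMeasure f y n, inferInstance⟩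
  have htight : IsTightMeasureSet
      {((μ : ProbabilityMeasure Y) : Measure Y) | μ ∈ Set.range μs} := by
    rw [isTightMeasureSet_iff_exists_isCompact_measure_compl_le]
    intro ε hε
    have hlim : Tendsto (fun c : ℝ => ENNReal.ofReal (C / c)) atTop (𝓝 0) := by
      simpa using ENNReal.tendsto_ofReal (tendsto_const_nhds (x := C).div_atTop tendsto_id)
    obtain ⟨c, hc, hc0⟩ := ((hlim.eventually (ge_mem_nhds hε)).and (eventually_gt_atTop 0)).exists
    refine ⟨{x | V x ≤ c}, hVc c, ?_⟩
    rintro _ ⟨_, ⟨n, rfl⟩, rfl⟩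
    exact (orbitMeasure_lt_le hV hV0 h hc0 n).trans hc
  have hcomp := isCompact_closure_of_isTightMeasureSet htight
  -- A limit along an ultrafilter replaces the choice of a convergent subsequence.
  set U : Ultrafilter ℕ := Ultrafilter.of atTop
  have hU : (U : Filter ℕ) ≤ atTop := Ultrafilter.of_le atTop
  obtain ⟨ν, -, hν⟩ := hcomp.ultrafilter_le_nhds (U.map μs) (by
    rw [le_principal_iff]
    exact Filter.mem_map.2 (Eventually.of_forall fun n => subset_closure ⟨n, rfl⟩))
  have hν : Tendsto μs U (𝓝 ν) := hν
  rw [ProbabilityMeasure.tendsto_iff_forall_integral_tendsto] at hν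
  refine ⟨ν, inferInstance, hf.measurable, ?_⟩
  have : IsProbabilityMeasure ((ν : Measure Y).map f) :=
    Measure.isProbabilityMeasure_map hf.measurable.aemeasurable
  refine ext_of_forall_integral_eq_of_IsFiniteMeasure fun g => ?_
  rw [integral_map hf.measurable.aemeasurable g.continuous.measurable.aestronglyMeasurable]
  have h1 := hν g
  have h2 := hν (g.compContinuous ⟨f, hf⟩)
  -- For bounded `g` the sums along the orbits of `y` and `f y` differ only in their end terms.
  have h3 : Tendsto (fun n => birkhoffAverage ℝ f g (n + 1) (f y) -
      birkhoffAverage ℝ f g (n + 1) y) atTop (𝓝 0) :=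
    (tendsto_add_atTop_iff_nat 1).2 
      (tendsto_birkhoffAverage_apply_sub_birkhoffAverage' ℝ g.isBounded_range f y)
  have h4 : Tendsto (fun n => (∫ x, g (f x) ∂orbitMeasure f y n) - ∫ x, g x ∂orbitMeasure f y n)
      atTop (𝓝 0) := by
    refine h3.congr fun n => ?_
    have hgf : StronglyMeasurable fun x => g (f x) := (g.continuous.comp hf).stronglyMeasurable
    rw [integral_orbitMeasure _ _ _ g.continuous.stronglyMeasurable,
      integral_orbitMeasure _ _ _ hgf]
    congr 1
    simp [birkhoffAverage, birkhoffSum, ← Function.iterate_succ_apply, Function.iterate_succ_apply']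
  exact sub_eq_zero.1 (tendsto_nhds_unique (h2.sub h1) (h4.mono_left hU))

end KrylovBogoliubov

/-! ### The weight update for a fixed row. -/

namespace AdaBoost

variable {m : ℕ}

theorem continuous_err (η : Row m) : Continuous (err η) := by
  refine continuous_finsetSum _ fun i _ => ?_
  split_ifs
  · exact continuous_apply i
  · exact continuous_const

theorem sum_false_eq_one_sub_err {w : Fin m → ℝ} (hw : w ∈ stdSimplex ℝ (Fin m)) (η : Row m) :
    ∑ i, (if η i then 0 else w i) = 1 - err η w := by
  rw [← hw.2, err, ← Finset.sum_sub_distrib]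
  refine Finset.sum_congr rfl fun i _ => ?_
  split_ifs <;> simp

theorem exists_pos_of_err_pos {η : Row m} {w : Fin m → ℝ} (h : 0 < err η w) :
    ∃ i, η i = true ∧ 0 < w i := by
  obtain ⟨i, -, hi⟩ := Finset.exists_lt_of_sum_lt (s := Finset.univ) (f := fun _ : Fin m => (0 : ℝ))
    (g := fun i => if η i then w i else 0) (by simpa [err] using h)
  refine ⟨i, ?_⟩
  by_cases hη : η i = true <;> simp_all

theorem err_pos_of_pos {η : Row m} {w : Fin m → ℝ} (hw : ∀ i, 0 ≤ w i) {i : Fin m}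
    (hη : η i = true) (hi : 0 < w i) : 0 < err η w := by
  refine Finset.sum_pos' (fun j _ => ?_) ⟨i, Finset.mem_univ i, by simpa [hη] using hi⟩
  split_ifs
  · exact hw j
  · exact le_rfl

theorem update_of_true {η : Row m} {i : Fin m} (hi : η i = true) (w : Fin m → ℝ) :
    update η w i = w i / (2 * err η w) := by
  simp only [update, hi, if_true]
  ring

theorem update_of_false {η : Row m} {i : Fin m} (hi : η i = false) (w : Fin m → ℝ) :
    update η w i = w i / (2 * (1 - err η w)) := by
  simp only [update, hi, Bool.false_eq_true, if_false]
  field_simp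

theorem err_update {η : Row m} {w : Fin m → ℝ} (h0 : 0 < err η w) :
    err η (update η w) = 1 / 2 := by
  have : err η (update η w) = err η w / (2 * err η w) := by
    conv_rhs => enter [1]; rw [err]
    rw [err, Finset.sum_div]
    refine Finset.sum_congr rfl fun i _ => ?_
    by_cases hi : η i = true
    · simp only [hi, if_true, update_of_true hi]
    · simp [hi]
  rw [this]
  field_simp

theorem update_mem_stdSimplex {η : Row m} {w : Fin m → ℝ} (hw : w ∈ stdSimplex ℝ (Fin m))
    (h0 : 0 < err η w) (h1 : err η w < 1) : update η w ∈ stdSimplex ℝ (Fin m) := by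
  have h1' : 0 < 1 - err η w := by linarith
  refine ⟨fun i => ?_, ?_⟩
  · have := hw.1 i
    cases hi : η i
    · rw [update_of_false hi]; positivity
    · rw [update_of_true hi]; positivity
  · have h2 : ∑ i, (if η i then 0 else update η w i) = (1 - err η w) / (2 * (1 - err η w)) := by
      rw [← sum_false_eq_one_sub_err hw, Finset.sum_div]
      refine Finset.sum_congr rfl fun i _ => ?_
      cases hi : η i
      · simp [update_of_false hi, sum_false_eq_one_sub_err hw]
      · simp
    have h3 : ∑ i, update η w i = err η (update η w) + ∑ i, (if η i then 0 else update η w i) := by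
      rw [err, ← Finset.sum_add_distrib]
      refine Finset.sum_congr rfl fun i _ => ?_
      split_ifs <;> simp
    rw [h3, h2, err_update h0]
    field_simp
    norm_num

theorem update_pos {η : Row m} {w : Fin m → ℝ} (h0 : 0 < err η w) (h1 : err η w < 1) {i : Fin m}
    (hi : 0 < w i) : 0 < update η w i := by
  have h1' : 0 < 1 - err η w := by linarith
  cases h : η i
  · rw [update_of_false h]; positivity
  · rw [update_of_true h]; positivity

theorem measurable_update (η : Row m) : Measurable (update η) := by
  have := (continuous_err η).measurable
  refine measurable_pi_lambda _ fun i => ?_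
  unfold update
  split_ifs <;> fun_prop

theorem continuousAt_update {η : Row m} {w : Fin m → ℝ} (h0 : 0 < err η w) (h1 : err η w < 1) :
    ContinuousAt (update η) w := by
  have hc := (continuous_err η).continuousAt (x := w)
  have hi : ∀ i : Fin m, ContinuousAt (fun v : Fin m → ℝ => v i) w :=
    fun i => (continuous_apply i).continuousAt
  refine continuousAt_pi.2 fun i => ?_
  unfold update
  refine (continuousAt_const.mul (hi i)).mul ?_
  split_ifs
  · exact continuousAt_const.div hc h0.ne'
  · exact continuousAt_const.div (continuousAt_const.sub hc) (by linarith)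

/-- Coordinates of weight zero add nothing to either error and remain zero. This makes the second
alternative of the no-ties assumption harmless. -/
theorem update_congr_of_eq_zero {η η' : Row m} {w : Fin m → ℝ}
    (h : ∀ i, η i ≠ η' i → w i = 0) : update η w = update η' w := by
  have he : err η w = err η' w := by
    refine Finset.sum_congr rfl fun i _ => ?_
    by_cases hi : η i = η' i
    · rw [hi]
    · simp [h i hi]
  funext i
  by_cases hi : η i = η' i
  · simp only [update, hi, he]
  · simp [update, h i hi]

/-! ### Integrability of the coefficients and convergence of the scores. -/

namespace Setup

variable {X : Type*} (S : Setup X m)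

theorem eps_le {η : Row m} (hη : η ∈ S.rows) (w : Fin m → ℝ) : S.eps w ≤ err η w :=
  csInf_le ((Set.toFinite S.rows).image _).bddBelow ⟨η, hη, rfl⟩

/-- The real infimum of the empty set is `0` by convention. -/
theorem rows_nonempty_of_eps_pos {w : Fin m → ℝ} (h : 0 < S.eps w) : S.rows.Nonempty := by
  by_contra hne
  rw [Set.not_nonempty_iff_eq_empty] at hne
  simp [eps, hne] at h

theorem exists_err_eq_eps (h : S.rows.Nonempty) (w : Fin m → ℝ) :
    ∃ η ∈ S.rows, err η w = S.eps w :=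
  (h.image fun η => err η w).csInf_mem ((Set.toFinite S.rows).image _)

theorem best_mem_argmin (h : S.rows.Nonempty) (w : Fin m → ℝ) : S.best w ∈ S.argmin w := by
  refine S.select_mem _ (fun η hη => hη.1) ?_
  obtain ⟨η, hη, he⟩ := S.exists_err_eq_eps h w
  exact ⟨η, hη, fun η' hη' => he ▸ S.eps_le hη' w⟩

theorem err_eq_eps_of_mem_argmin {w : Fin m → ℝ} {η : Row m} (hη : η ∈ S.argmin w) :
    err η w = S.eps w := by
  obtain ⟨η', hη', he⟩ := S.exists_err_eq_eps ⟨η, hη.1⟩ w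
  exact le_antisymm (he ▸ hη.2 η' hη') (S.eps_le hη.1 w)

theorem err_best {w : Fin m → ℝ} (hw : w ∈ S.dom) : err (S.best w) w = S.eps w :=
  S.err_eq_eps_of_mem_argmin (S.best_mem_argmin (S.rows_nonempty_of_eps_pos hw.2.1) w)

theorem continuous_eps : Continuous S.eps := by
  rcases S.rows.eq_empty_or_nonempty with h | h
  · have : S.eps = fun _ => 0 := by
      funext w
      simp [eps, h]
    rw [this]
    exact continuous_const
  · have : S.eps = fun w => (Set.toFinite S.rows).toFinset.inf' (by simpa using h)
        fun η => err η w := by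
      funext w
      rw [Finset.inf'_eq_csInf_image]
      simp [eps]
    rw [this]
    exact Continuous.finset_inf'_apply _ fun η _ => continuous_err η

/-- The row just used acquires error exactly `1/2`, and positive coordinates stay positive, so no
row's error drops to zero. -/
theorem ada_mem_dom_and_eps_ada_le {w : Fin m → ℝ} (hw : w ∈ S.dom) :
    S.ada w ∈ S.dom ∧ S.eps (S.ada w) ≤ 1 / 2 := by
  have hr := S.rows_nonempty_of_eps_pos hw.2.1
  have he := S.err_best hw
  have h0 : 0 < err (S.best w) w := he ▸ hw.2.1
  have h1 : err (S.best w) w < 1 := he ▸ hw.2.2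
  have hs : S.ada w ∈ stdSimplex ℝ (Fin m) := update_mem_stdSimplex hw.1 h0 h1
  have hle : S.eps (S.ada w) ≤ 1 / 2 :=
    (S.eps_le (S.best_mem_argmin hr w).1 _).trans (err_update h0).le
  refine ⟨⟨hs, ?_, by linarith⟩, hle⟩
  obtain ⟨η, hη, hη'⟩ := S.exists_err_eq_eps hr (S.ada w)
  rw [← hη']
  obtain ⟨i, hi, hi'⟩ := exists_pos_of_err_pos (hw.2.1.trans_le (S.eps_le hη w))
  exact err_pos_of_pos hs.1 hi (update_pos h0 h1 hi')

theorem neg_log_two_le_log_ada_sub {w : Fin m → ℝ} (hw : w ∈ S.dom) (he : S.eps w ≤ 1 / 2)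
    (i : Fin m) : -Real.log 2 ≤ Real.log (S.ada w i) - Real.log (w i) := by
  have h2 : 0 ≤ Real.log 2 := Real.log_nonneg (by norm_num)
  have hp := hw.2.1
  rcases (hw.1.1 i).eq_or_lt with h | h
  -- A zero coordinate stays zero, and `Real.log 0 = 0` makes its increment vanish.
  · have : S.ada w i = 0 := by simp [ada, update, ← h]
    rw [this, ← h]
    linarith
  · rw [ada]
    cases hi : S.best w i
    · rw [update_of_false hi, S.err_best hw, Real.log_div h.ne' (by linarith)]
      have := Real.log_le_log (by linarith) (show 2 * (1 - S.eps w) ≤ 2 by linarith)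
      linarith
    · rw [update_of_true hi, S.err_best hw, Real.log_div h.ne' (by linarith)]
      have := Real.log_nonpos (by linarith) (show 2 * S.eps w ≤ 1 by linarith)
      linarith

theorem neg_log_eps_le_sum {w : Fin m → ℝ} (hw : w ∈ S.dom) (he : S.eps w ≤ 1 / 2) :
    -Real.log (2 * S.eps w) ≤ ∑ i, (Real.log (S.ada w i) - Real.log (w i) + Real.log 2) := by
  have hp := hw.2.1
  obtain ⟨i, hi, hi'⟩ := exists_pos_of_err_pos ((S.err_best hw).symm ▸ hp)
  have h1 : Real.log (S.ada w i) - Real.log (w i) = -Real.log (2 * S.eps w) := by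
    rw [ada, update_of_true hi, S.err_best hw, Real.log_div hi'.ne' (by linarith)]
    ring
  have h2 : 0 ≤ Real.log 2 := Real.log_nonneg (by norm_num)
  calc -Real.log (2 * S.eps w) ≤ Real.log (S.ada w i) - Real.log (w i) + Real.log 2 := by linarith
    _ ≤ _ := Finset.single_le_sum
      (f := fun i => Real.log (S.ada w i) - Real.log (w i) + Real.log 2)
      (fun j _ => by linarith [S.neg_log_two_le_log_ada_sub hw he j]) (Finset.mem_univ i)

theorem abs_alpha_le {w : Fin m → ℝ} (hp : 0 < S.eps w) (he : S.eps w ≤ 1 / 2) :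
    |S.alpha w| ≤ 1 / 2 * (-Real.log (2 * S.eps w) + Real.log 2) := by
  have h0 : 0 ≤ S.alpha w := by
    refine mul_nonneg (by norm_num) (Real.log_nonneg ?_)
    rw [le_div_iff₀ hp]
    linarith
  rw [abs_of_nonneg h0, alpha, Real.log_div (by linarith) hp.ne', Real.log_mul (by norm_num) hp.ne']
  have := Real.log_nonpos (show 0 ≤ 1 - S.eps w by linarith) (by linarith)
  linarith

/-- The minimisers are determined by finitely many comparisons of continuous functions, and any
tie-breaking rule on a finite type is measurable. -/
theorem measurable_best : Measurable S.best := by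
  have h1 : Measurable S.argmin := by
    refine measurable_set_iff.2 fun η => ?_
    refine measurable_const.and ?_
    refine Measurable.forall fun η' => ?_
    refine measurable_const.imp ?_
    exact measurableSet_setOfPred.1
      (measurableSet_le (continuous_err η).measurable (continuous_err η').measurable)
  exact (measurable_of_countable S.select).comp h1

theorem measurable_ada : Measurable S.ada := by
  have : Measurable fun p : Row m × (Fin m → ℝ) => update p.1 p.2 :=
    measurable_from_prod_countable_right fun η => measurable_update η
  exact this.comp (S.measurable_best.prodMk measurable_id)

theorem measurable_alpha : Measurable S.alpha := by
  have := S.continuous_eps.measurable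
  unfold alpha
  fun_prop

/-- The coefficient `α(w)` where the row `η` is selected, and zero elsewhere. -/
def rowAlpha (η : Row m) (w : Fin m → ℝ) : ℝ := if S.best w = η then S.alpha w else 0

theorem measurable_rowAlpha (η : Row m) : Measurable (S.rowAlpha η) :=
  Measurable.ite (S.measurable_best (measurableSet_singleton η)) S.measurable_alpha measurable_const

theorem integrable_rowAlpha {μ : Measure (Fin m → ℝ)} (hμ : S.IsInvariant μ) (η : Row m) :
    Integrable (S.rowAlpha η) μ := by
  have := hμ.prob
  -- The bound holds after one round, and invariance transfers it to almost every starting point.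
  have hle : ∀ᵐ w ∂μ, S.eps w ≤ 1 / 2 := by
    have hm : MeasurableSet {w | S.eps w ≤ 1 / 2} :=
      measurableSet_le S.continuous_eps.measurable measurable_const
    rw [← hμ.preserving.map_eq, ae_map_iff hμ.preserving.measurable.aemeasurable hm]
    filter_upwards [hμ.defined] with w hw using (S.ada_mem_dom_and_eps_ada_le hw).2
  have hG : ∀ i : Fin m, Integrable (fun w => Real.log (S.ada w i) - Real.log (w i)) μ :=
    fun i => by
    refine integrable_comp_sub_of_nonpos hμ.preserving (h := fun w => Real.log (w i))
      (C := Real.log 2) (by fun_prop) ?_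
      (Real.log_nonneg (by norm_num)) ?_
    · filter_upwards [hμ.defined] with w hw
      exact Real.log_nonpos (hw.1.1 i)
        ((Finset.single_le_sum (fun j _ => hw.1.1 j) (Finset.mem_univ i)).trans hw.1.2.le)
    · filter_upwards [hμ.defined, hle] with w hw he using S.neg_log_two_le_log_ada_sub hw he i
  have hbd : Integrable (fun w => 1 / 2 * (∑ i, (Real.log (S.ada w i) - Real.log (w i) +
      Real.log 2) + Real.log 2)) μ :=
    ((integrable_finsetSum _ fun i _ => (hG i).add (integrable_const _)).add
      (integrable_const _)).const_mul _
  refine hbd.mono' (S.measurable_rowAlpha η).aestronglyMeasurable ?_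
  filter_upwards [hμ.defined, hle] with w hw he
  have h1 := S.abs_alpha_le hw.2.1 he
  have h2 := S.neg_log_eps_le_sum hw he
  have h3 : ‖S.rowAlpha η w‖ ≤ |S.alpha w| := by
    unfold rowAlpha
    split_ifs
    · exact le_rfl
    · simp
  linarith

/-- The point `x` enters only through finitely many signs, so convergence of the row averages gives
all `x` at once. -/
theorem inv_mul_score_eq_sum (w : Fin m → ℝ) (T : ℕ) (x : X) :
    1 / (T : ℝ) * S.score w T x =
      ∑ η, birkhoffAverage ℝ S.ada (S.rowAlpha η) T w * pm (S.rep η x) := by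
  simp only [birkhoffAverage, birkhoffSum, smul_eq_mul, mul_assoc, ← Finset.mul_sum, one_div, score,
    Finset.sum_mul]
  rw [Finset.sum_comm]
  congr 1
  refine Finset.sum_congr rfl fun t _ => ?_
  simp [rowAlpha, ite_mul]

/-- Convergence of all the average scores for almost every initial weight. -/
theorem ae_exists_tendsto_average_score {μ : Measure (Fin m → ℝ)} (hμ : S.IsInvariant μ) :
    ∀ᵐ w ∂μ, ∃ F : X → ℝ, ∀ x,
      Tendsto (fun T : ℕ => 1 / (T : ℝ) * S.score w T x) atTop (𝓝 (F x)) := by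
  have := hμ.prob
  have h : ∀ᵐ w ∂μ, ∀ η, ∃ c : ℝ,
      Tendsto (fun T => birkhoffAverage ℝ S.ada (S.rowAlpha η) T w) atTop (𝓝 c) :=
    ae_all_iff.2 fun η => ae_tendsto_birkhoffAverage_of_measurable hμ.preserving
      (S.measurable_rowAlpha η) (S.integrable_rowAlpha hμ η)
  filter_upwards [h] with w hw
  choose c hc using hw
  refine ⟨fun x => ∑ η, c η * pm (S.rep η x), fun x => ?_⟩
  simp_rw [inv_mul_score_eq_sum]
  exact tendsto_finsetSum _ fun η _ => (hc η).mul_const _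

/-- Where the average score has a nonzero limit, the classifier is eventually constant. -/
theorem tendsto_classifier {w : Fin m → ℝ} {x : X} {c : ℝ} (hc : c ≠ 0)
    (h : Tendsto (fun T : ℕ => 1 / (T : ℝ) * S.score w T x) atTop (𝓝 c)) :
    Tendsto (fun T : ℕ => S.classifier w T x) atTop (𝓝 (Real.sign c)) := by
  refine tendsto_const_nhds.congr' ?_
  rcases hc.lt_or_gt with hc | hc
  · filter_upwards [h.eventually (gt_mem_nhds hc), eventually_gt_atTop 0] with T hT hT0
    have hT0 : (0 : ℝ) < 1 / (T : ℝ) := by positivity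
    rw [classifier, Real.sign_of_neg hc, Real.sign_of_neg ((pos_iff_neg_of_mul_neg hT).1 hT0)]
  · filter_upwards [h.eventually (lt_mem_nhds hc), eventually_gt_atTop 0] with T hT hT0
    have hT0 : (0 : ℝ) < 1 / (T : ℝ) := by positivity
    rw [classifier, Real.sign_of_pos hc, Real.sign_of_pos ((pos_iff_pos_of_mul_pos hT).1 hT0)]

end Setup

end AdaBoost

/-! ### Existence of an invariant measure without ties. -/

namespace AdaBoost

namespace Setup

variable {X : Type*} {m : ℕ} (S : Setup X m)

theorem mem_dom_of_mem_attractor {w : Fin m → ℝ} (hw : w ∈ S.attractor) :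
    w ∈ S.dom ∧ S.eps w ≤ 1 / 2 := by
  obtain ⟨v, hv, rfl⟩ := Set.mem_iInter.1 hw 0
  exact S.ada_mem_dom_and_eps_ada_le hv

theorem ada_mem_attractor {w : Fin m → ℝ} (hw : w ∈ S.attractor) : S.ada w ∈ S.attractor := by
  refine Set.mem_iInter.2 fun t => ?_
  obtain ⟨v, hv, rfl⟩ := Set.mem_iInter.1 hw t
  exact ⟨S.ada v, (S.ada_mem_dom_and_eps_ada_le hv).1,
    by rw [← Function.iterate_succ_apply, Function.iterate_succ_apply']⟩

theorem iterate_mem_attractor {w : Fin m → ℝ} (hw : w ∈ S.attractor) (t : ℕ) :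
    S.ada^[t] w ∈ S.attractor := by
  induction t with
  | zero => exact hw
  | succ t ih => exact Function.iterate_succ_apply' S.ada t w ▸ S.ada_mem_attractor ih

/-- The rows selected near `w` all have least error at `w`. -/
theorem eventually_best_mem_argmin {w : Fin m → ℝ} (hr : S.rows.Nonempty) :
    ∀ᶠ v in 𝓝 w, S.best v ∈ S.argmin w := by
  have h : ∀ᶠ v in 𝓝 w, ∀ η ∈ S.rows, η ∉ S.argmin w → S.eps v < err η v := by
    rw [eventually_all]
    intro η
    by_cases hη : η ∈ S.rows ∧ η ∉ S.argmin w
    · have hlt : S.eps w < err η w := by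
        refine lt_of_le_of_ne (S.eps_le hη.1 w) fun heq => hη.2 ⟨hη.1, fun η' hη' => ?_⟩
        exact heq ▸ S.eps_le hη' w
      filter_upwards [S.continuous_eps.continuousAt.eventually_lt
        (continuous_err η).continuousAt hlt] with v hv _ _ using hv
    · exact Eventually.of_forall fun v h1 h2 => absurd ⟨h1, h2⟩ hη
  filter_upwards [h] with v hv
  have hb := S.best_mem_argmin hr v
  by_contra hn
  exact (hv _ hb.1 hn).ne (S.err_eq_eps_of_mem_argmin hb).symm

/-- Without ties the update is continuous. -/
theorem continuousOn_ada {G : Set (Fin m → ℝ)}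
    (hG : ∀ η ∈ S.rows, ∀ η' ∈ S.rows, S.region η ∩ S.region η' ∩ G = ∅ ∨
      ∀ w ∈ G, ∑ i with η i ≠ η' i, w i = 0) :
    ContinuousOn S.ada (G ∩ S.dom) := by
  intro w hw
  have hr := S.rows_nonempty_of_eps_pos hw.2.2.1
  have hb := S.best_mem_argmin hr w
  have he := S.err_best hw.2
  have hc : ContinuousWithinAt (update (S.best w)) (G ∩ S.dom) w :=
    (continuousAt_update (he ▸ hw.2.2.1) (he ▸ hw.2.2.2)).continuousWithinAt
  refine hc.congr_of_eventuallyEq ?_ rfl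
  filter_upwards [mem_nhdsWithin_of_mem_nhds (S.eventually_best_mem_argmin hr),
    self_mem_nhdsWithin] with v hv hvG
  -- The row selected at `v` and the one selected at `w` are both optimal at `w`, so their regions
  -- meet in `G` and they differ only in coordinates of weight zero.
  have h0 := (hG _ hv.1 _ hb.1).resolve_left
    (Set.Nonempty.ne_empty ⟨w, ⟨⟨hw.2.1, hv⟩, ⟨hw.2.1, hb⟩⟩, hw.1⟩) v hvG.1
  refine update_congr_of_eq_zero fun i hi => ?_
  exact (Finset.sum_eq_zero_iff_of_nonneg fun j _ => hvG.2.1.1 j).1 h0 i (by simpa using hi)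

/-- A Birkhoff sum of `-log (2 ε)` is at most linear in its length. -/
theorem sum_neg_log_eps_le {w : Fin m → ℝ} (hw : w ∈ S.attractor) (n : ℕ) :
    ∑ t ∈ Finset.range (n + 1), -Real.log (2 * S.eps (S.ada^[t] w)) ≤
      (m * Real.log 2 - ∑ i, Real.log (w i)) * (n + 1 : ℕ) := by
  have hlog : ∀ v ∈ S.attractor, ∀ i, Real.log (v i) ≤ 0 := fun v hv i => by
    have hs := (S.mem_dom_of_mem_attractor hv).1.1
    exact Real.log_nonpos (hs.1 i)
      ((Finset.single_le_sum (fun j _ => hs.1 j) (Finset.mem_univ i)).trans hs.2.le)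
  calc ∑ t ∈ Finset.range (n + 1), -Real.log (2 * S.eps (S.ada^[t] w))
      ≤ ∑ t ∈ Finset.range (n + 1), ∑ i, (Real.log (S.ada^[t + 1] w i) -
          Real.log (S.ada^[t] w i) + Real.log 2) := by
        refine Finset.sum_le_sum fun t _ => ?_
        have h := S.mem_dom_of_mem_attractor (S.iterate_mem_attractor hw t)
        simpa only [Function.iterate_succ_apply'] using S.neg_log_eps_le_sum h.1 h.2
    _ = ∑ i, (Real.log (S.ada^[n + 1] w i) - Real.log (w i) + (n + 1 : ℕ) * Real.log 2) := by
        rw [Finset.sum_comm]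
        refine Finset.sum_congr rfl fun i _ => ?_
        rw [Finset.sum_add_distrib,
          Finset.sum_range_sub (fun t => Real.log (S.ada^[t] w i))]
        simp
    _ ≤ ∑ i, (-Real.log (w i) + (n + 1 : ℕ) * Real.log 2) := by
        refine Finset.sum_le_sum fun i _ => ?_
        linarith [hlog _ (S.iterate_mem_attractor hw (n + 1)) i]
    _ = -(∑ i, Real.log (w i)) + m * Real.log 2 * (n + 1 : ℕ) := by
        rw [Finset.sum_add_distrib, Finset.sum_neg_distrib]
        simp only [Finset.sum_const, Finset.card_univ, Fintype.card_fin, nsmul_eq_mul]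
        ring
    _ ≤ _ := by
        -- The initial term is nonnegative, so multiplying it by `n + 1 ≥ 1` only weakens the bound.
        have h1 : ∑ i, Real.log (w i) ≤ 0 := Finset.sum_nonpos fun i _ => hlog w hw i
        have h2 : (1 : ℝ) ≤ (n + 1 : ℕ) := by exact_mod_cast Nat.le_add_left 1 n
        nlinarith

theorem exists_isInvariant (hG : S.NoTies) (hne : S.attractor.Nonempty) :
    ∃ μ : Measure (Fin m → ℝ), S.IsInvariant μ := by
  obtain ⟨G, hGc, hGs, hGa, hties⟩ := hG
  obtain ⟨w₀, hw₀⟩ := hne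
  set O : Set (Fin m → ℝ) := Set.range fun t => S.ada^[t] w₀ with hO
  have hOa : O ⊆ S.attractor := by
    rintro _ ⟨t, rfl⟩
    exact S.iterate_mem_attractor hw₀ t
  have hKG : closure O ⊆ G := closure_minimal (hOa.trans hGa) hGc.isClosed
  have hKc : IsCompact (closure O) := hGc.of_isClosed_subset isClosed_closure hKG
  have hKe : closure O ⊆ {w | S.eps w ≤ 1 / 2} :=
    closure_minimal (fun w hw => (S.mem_dom_of_mem_attractor (hOa hw)).2)
      (isClosed_le S.continuous_eps continuous_const)
  -- The closure may contain points with `ε = 0`, outside the domain. Removing them costs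
  -- compactness, which the proper function `V` below replaces.
  set Y : Set (Fin m → ℝ) := closure O ∩ {w | 0 < S.eps w} with hY
  have hYd : Y ⊆ G ∩ S.dom := fun w hw => by
    have : S.eps w ≤ 1 / 2 := hKe hw.1
    exact ⟨hKG hw.1, hGs (hKG hw.1), hw.2, by linarith⟩
  have hOY : O ⊆ Y := fun w hw => ⟨subset_closure hw, (S.mem_dom_of_mem_attractor (hOa hw)).1.2.1⟩
  have hcont : ContinuousOn S.ada Y := (S.continuousOn_ada hties).mono hYd
  have hmaps : Set.MapsTo S.ada Y Y := fun w hw => by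
    refine ⟨((hcont w hw).mono hOY).mem_closure hw.1 ?_,
      (S.ada_mem_dom_and_eps_ada_le (hYd hw).2).1.2.1⟩
    rintro _ ⟨t, rfl⟩
    exact ⟨t + 1, Function.iterate_succ_apply' _ _ _⟩
  have hfc : Continuous (hmaps.restrict S.ada Y Y) := hcont.mapsToRestrict hmaps
  set V : Y → ℝ := fun w => -Real.log (2 * S.eps w) with hV
  have hVm : Measurable V := by
    have := S.continuous_eps.measurable
    fun_prop
  -- A bound on `V` keeps `ε` away from zero, so the sublevel set is closed in the compact orbit
  -- closure.
  have hVc : ∀ c, IsCompact {w | V w ≤ c} := fun c => by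
    have himage : (Subtype.val '' {w | V w ≤ c} : Set (Fin m → ℝ)) =
        closure O ∩ {w | Real.exp (-c) ≤ 2 * S.eps w} := by
      ext w
      have hiff : 0 < S.eps w → (-Real.log (2 * S.eps w) ≤ c ↔ Real.exp (-c) ≤ 2 * S.eps w) :=
        fun h => by rw [← Real.le_log_iff_exp_le (by linarith), neg_le]
      constructor
      · rintro ⟨v, hv, rfl⟩
        exact ⟨v.2.1, (hiff v.2.2).1 hv⟩
      · rintro ⟨h1, h2⟩
        have h2 : Real.exp (-c) ≤ 2 * S.eps w := h2
        have h3 : 0 < S.eps w := by linarith [Real.exp_pos (-c)]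
        exact ⟨⟨w, h1, h3⟩, (hiff h3).2 h2, rfl⟩
    rw [Subtype.isCompact_iff, himage]
    exact hKc.inter_right (isClosed_le continuous_const (continuous_const.mul S.continuous_eps))
  have hy₀ : w₀ ∈ Y := hOY ⟨0, rfl⟩
  have hiter : ∀ t, (((hmaps.restrict S.ada Y Y)^[t] ⟨w₀, hy₀⟩ : Y) : Fin m → ℝ) =
      S.ada^[t] w₀ := fun t =>
    (Function.Semiconj.iterate_right (f := Subtype.val) (fun _ => rfl) t).eq _
  obtain ⟨ν, hν, hpres⟩ := exists_measurePreserving_of_birkhoffSum_le hfc (y := ⟨w₀, hy₀⟩) hVm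
    (fun w => by
      have h1 : S.eps w ≤ 1 / 2 := hKe w.2.1
      have h2 : 0 < S.eps w := w.2.2
      exact neg_nonneg.2 (Real.log_nonpos (by linarith) (by linarith))) hVc
    (C := m * Real.log 2 - ∑ i, Real.log (w₀ i)) fun n => by
      simpa only [birkhoffSum, hV, hiter] using S.sum_neg_log_eps_le hw₀ n
  have hYm : MeasurableSet Y := isClosed_closure.measurableSet.inter
    (measurableSet_lt measurable_const S.continuous_eps.measurable)
  refine ⟨ν.map Subtype.val, Measure.isProbabilityMeasure_map measurable_subtype_coe.aemeasurable,
    ?_, S.measurable_ada, ?_⟩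
  · have h : ∀ᵐ w ∂ν.map Subtype.val, w ∈ Y :=
      (ae_map_iff measurable_subtype_coe.aemeasurable hYm).2 (Eventually.of_forall fun w => w.2)
    exact h.mono fun w hw => (hYd hw).2
  · rw [Measure.map_map S.measurable_ada measurable_subtype_coe]
    conv_rhs => rw [← hpres.map_eq, Measure.map_map measurable_subtype_coe hpres.measurable]
    rfl

end Setup

end AdaBoost

end

theorem mainTheorem8 {X : Type*} {m : ℕ} (S : AdaBoost.Setup X m)
    [MeasurableSpace (X × Bool)] (P : Measure (X × Bool)) [IsProbabilityMeasure P] :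
    -- no ties: an invariant probability measure exists
    (S.NoTies → S.attractor.Nonempty → ∃ μ : Measure (Fin m → ℝ), S.IsInvariant μ) ∧
    -- almost every initial weight: the averages converge, and so does the classifier
    (∀ μ : Measure (Fin m → ℝ), S.IsInvariant μ → ∀ᵐ w₁ ∂μ,
      ∃ Fstar : X → ℝ,
        (∀ x, Tendsto (fun T : ℕ => 1 / (T : ℝ) * S.score w₁ T x) atTop (𝓝 (Fstar x))) ∧
        ((∀ᵐ z ∂P, Fstar z.1 ≠ 0) →
          ∀ᵐ z ∂P, Tendsto (fun T : ℕ => S.classifier w₁ T z.1) atTop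
            (𝓝 (Real.sign (Fstar z.1))))) ∧
    -- every initial weight for which the averages have a nonzero limit almost everywhere
    (∀ w₁ ∈ S.dom, ∀ Fstar : X → ℝ,
      (∀ᵐ z ∂P, Tendsto (fun T : ℕ => 1 / (T : ℝ) * S.score w₁ T z.1) atTop (𝓝 (Fstar z.1)) ∧
        Fstar z.1 ≠ 0) →
      ∀ᵐ z ∂P, Tendsto (fun T : ℕ => S.classifier w₁ T z.1) atTop
        (𝓝 (Real.sign (Fstar z.1)))) := by
  refine ⟨S.exists_isInvariant, fun μ hμ => ?_, fun w₁ _ F hF => ?_⟩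
  · filter_upwards [S.ae_exists_tendsto_average_score hμ] with w hw
    obtain ⟨F, hF⟩ := hw
    exact ⟨F, hF, fun hne => hne.mono fun z hz => S.tendsto_classifier hz (hF z.1)⟩
  · exact hF.mono fun z hz => S.tendsto_classifier hz.2 hz.1
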